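/- Let $G$ be a countable group and let $\mathfrak B$ be a set with commuting left and right actions of $G$ such that the right action is free and has finitely many orbits (so $(G,\mathfrak B)$ is a self-similar group). A basis of $\mathfrak B$ is a subset $\mathsf X\subset\mathfrak B$ meeting every right $G$-orbit exactly once; $\mathsf X^n=\{x_n\otimes\cdots\otimes x_1 : x_i\in\mathsf X\}\subset\mathfrak B^{\otimes n}$ denotes the set of words of length $n$, where $\mathfrak B^{\otimes 0}=G$. For $g\in G$ and $v\in\mathsf X^n$ the section $g|_v\in G$ is the unique element with $g\cdot v=w\cdot g|_v$ in $\mathfrak B^{\otimes n}$ for some $w\in\mathsf X^n$. Assume that $(G,\mathfrak B)$ is contracting: for some basis there is a finite set $\mathcal N\subset G$ such that for every $g\in G$ there exists $n$ with $g|_v\in\mathcal N$ for all words $v$ of length at least $n$. Let $\mathsf X$ be any basis of $\mathfrak B$, and let $\mathsf X^{-\omega}$ be the space of left-infinite sequences $\ldots x_2x_1$ of elements of $\mathsf X$, with the product topology of the discrete sets $\mathsf X$. The limit $G$-space $\mathcal X_G$ is the quotient of $\mathsf X^{-\omega}\times G$ ($G$ discrete) by the equivalence relation under which $(\ldots x_2x_1,g)$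 and $(\ldots y_2y_1,h)$ are identified if there is a sequence $(g_n)$ taking values in a finite subset of $G$ such that $g_n\cdot x_n\otimes\cdots\otimes x_1\cdot g=y_n\otimes\cdots\otimes y_1\cdot h$ in $\mathfrak B^{\otimes n}$ for every $n$. The group $G$ acts on it from the right by $(\ldots x_2x_1,g)\cdot k=(\ldots x_2x_1,gk)$. The limit space is the orbit space $\mathcal J_G=\mathcal X_G/G$ with the quotient topology. A topological space has covering dimension $\le d$ if every open cover has an open refinement covering the space such that every point is contained in at most $d+1$ elements of the refinement; $\dim$ is the smallest such integer $d\ge 0$, or $\infty$ if there is none, and $\dim\emptyset=-1$. Then $$\dim\mathcal X_G=\dim\mathcal J_G.$$ -/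

import Mathlib

open MulOpposite

universe u

/-- A `G`-biset: a set with commuting left and right actions of `G`. The right action is written
as an action of `Gᵐᵒᵖ`, that is, `x · g` is `op g • x`. -/
structure Biset (G : Type u) [Group G] where
  carrier : Type u
  leftAction : MulAction G carrier
  rightAction : MulAction Gᵐᵒᵖ carrier
  actions_commute : SMulCommClass G Gᵐᵒᵖ carrier

namespace Biset

variable {G : Type u} [Group G]

instance : CoeSort (Biset G) (Type u) := ⟨Biset.carrier⟩

instance (B : Biset G) : MulAction G B := B.leftAction

instance (B : Biset G) : MulAction Gᵐᵒᵖ B := B.rightAction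

instance (B : Biset G) : SMulCommClass G Gᵐᵒᵖ B := B.actions_commute

/-- `(G, B)` is a self-similar group: the right action is free and has finitely many orbits. -/
structure IsSelfSimilar (B : Biset G) : Prop where
  free : ∀ (x : B) (g : G), op g • x = x → g = 1
  finite_orbits : Finite (MulAction.orbitRel.Quotient Gᵐᵒᵖ B)

/-- A basis of `B`: a subset intersecting every right orbit exactly once. -/
def IsBasis (B : Biset G) (X : Set B) : Prop :=
  ∀ b : B, ∃! x : B, x ∈ X ∧ x ∈ MulAction.orbit Gᵐᵒᵖ b

/-- The orbit equivalence relation of the action `(x₁, x₂) ↦ (x₁ · g⁻¹, g · x₂)`. -/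
def tensorSetoid (B₁ B₂ : Biset G) : Setoid (B₁ × B₂) where
  r p q := ∃ g : G, q = (op g⁻¹ • p.1, g • p.2)
  iseqv :=
    { refl := fun p => ⟨1, by simp⟩
      symm := by
        rintro p _ ⟨g, rfl⟩
        exact ⟨g⁻¹, by simp [← mul_smul]⟩
      trans := by
        rintro p _ _ ⟨g, rfl⟩ ⟨h, rfl⟩
        exact ⟨h * g, by simp [mul_smul]⟩ }

/-- The left action on `B₁ ⊗ B₂`: `g · (x₁ ⊗ x₂) = (g · x₁) ⊗ x₂`. -/
instance tensorLeftAction (B₁ B₂ : Biset G) : MulAction G (Quotient (tensorSetoid B₁ B₂)) where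
  smul h := Quotient.map (fun p => (h • p.1, p.2)) (by
    rintro p _ ⟨g, rfl⟩
    exact ⟨g, by simp [smul_comm]⟩)
  one_smul := by
    rintro ⟨p⟩
    exact congrArg (Quotient.mk _) (by simp)
  mul_smul := by
    rintro g h ⟨p⟩
    exact congrArg (Quotient.mk _) (by simp [mul_smul])

/-- The right action on `B₁ ⊗ B₂`: `(x₁ ⊗ x₂) · g = x₁ ⊗ (x₂ · g)`. -/
instance tensorRightAction (B₁ B₂ : Biset G) :
    MulAction Gᵐᵒᵖ (Quotient (tensorSetoid B₁ B₂)) where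
  smul h := Quotient.map (fun p => (p.1, h • p.2)) (by
    rintro p _ ⟨g, rfl⟩
    exact ⟨g, by simp [smul_comm]⟩)
  one_smul := by
    rintro ⟨p⟩
    exact congrArg (Quotient.mk _) (by simp)
  mul_smul := by
    rintro g h ⟨p⟩
    exact congrArg (Quotient.mk _) (by simp [mul_smul])

/-- The tensor product `B₁ ⊗ B₂`. -/
def tensor (B₁ B₂ : Biset G) : Biset G where
  carrier := Quotient (tensorSetoid B₁ B₂)
  leftAction := tensorLeftAction B₁ B₂
  rightAction := tensorRightAction B₁ B₂
  actions_commute :=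
    ⟨by
      rintro g h ⟨p⟩
      rfl⟩

/-- The group `G` as a `G`-biset. -/
def unit (G : Type u) [Group G] : Biset G where
  carrier := G
  leftAction := inferInstance
  rightAction := inferInstance
  actions_commute := inferInstance

/-- The tensor powers of a biset: `B^{⊗ 0} = G` and `B^{⊗ (n + 1)} = B ⊗ B^{⊗ n}`. -/
def tensorPow (B : Biset G) : ℕ → Biset G
  | 0 => unit G
  | n + 1 => tensor B (tensorPow B n)

/-- The element `x_n ⊗ x_{n-1} ⊗ ⋯ ⊗ x_1` of `B^{⊗ n}`; the letter `x_{i+1}` is `x i`. -/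
def word (B : Biset G) : (n : ℕ) → (Fin n → B) → tensorPow B n
  | 0, _ => (1 : G)
  | n + 1, x => Quotient.mk (tensorSetoid B (tensorPow B n))
      (x (Fin.last n), word B n (fun i => x i.castSucc))

/-- `h` is the section `g|_v` of `g` in the word `v` over `X`: there is a word `w = g(v)` over `X`
of the same length such that `g · v = w · h` in `B^{⊗ n}`. -/
def IsSection (B : Biset G) (X : Set B) (g : G) {n : ℕ} (v : Fin n → X) (h : G) : Prop :=
  ∃ w : Fin n → X,
    g • B.word n (fun i => (v i : B)) = op h • B.word n (fun i => (w i : B))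

/-- Sections with respect to a basis exist and are unique. -/
theorem IsSelfSimilar.existsUnique_section {B : Biset G} (hB : B.IsSelfSimilar) {X : Set B}
    (hX : B.IsBasis X) (g : G) {n : ℕ} (v : Fin n → X) : ∃! h : G, B.IsSection X g v h := by
  have key : ∀ (n : ℕ) (w w' : Fin n → X) (h h' : G),
      op h • B.word n (fun i => (w i : B)) = op h' • B.word n (fun i => (w' i : B)) →
        h = h' := by
    intro n
    induction n with
    | zero =>
      intro w w' h h' e
      have e' : (1 : G) * h = 1 * h' := e
      simpa using e'
    | succ n ih =>
      intro w w' h h' e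
      obtain ⟨k, hk⟩ := Quotient.exact e
      have h1 : ((w' (Fin.last n) : X) : B) = op k⁻¹ • ((w (Fin.last n) : X) : B) :=
        congrArg Prod.fst hk
      have h2 : op h' • B.word n (fun i => (w' i.castSucc : B)) =
          k • op h • B.word n (fun i => (w i.castSucc : B)) := congrArg Prod.snd hk
      have h3 : ((w' (Fin.last n) : X) : B) = ((w (Fin.last n) : X) : B) :=
        (hX (w (Fin.last n) : B)).unique ⟨(w' _).2, ⟨op k⁻¹, h1.symm⟩⟩
          ⟨(w _).2, MulAction.mem_orbit_self _⟩
      have h4 : k⁻¹ = 1 := hB.free _ _ (h1.symm.trans h3)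
      have h5 : k = 1 := inv_eq_one.mp h4
      rw [h5, one_smul] at h2
      exact (ih _ _ _ _ h2).symm
  have ex : ∀ (n : ℕ) (g : G) (v : Fin n → X), ∃ h : G, B.IsSection X g v h := by
    intro n
    induction n with
    | zero => exact fun g v => ⟨g, v, show g * (1 : G) = 1 * g by simp⟩
    | succ n ih =>
      intro g v
      obtain ⟨y, ⟨hy, ⟨k, hk⟩⟩, -⟩ := hX (g • (v (Fin.last n) : B))
      obtain ⟨h, w, hw⟩ := ih k.unop⁻¹ (fun i => v i.castSucc)
      refine ⟨h, Fin.snoc w ⟨y, hy⟩, ?_⟩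
      have hw' : op h • B.word n (fun i => (w i : B)) =
          k.unop⁻¹ • B.word n (fun i => (v i.castSucc : B)) := hw.symm
      refine Quotient.sound ⟨k.unop⁻¹, ?_⟩
      simp [hw', ← hk]
  obtain ⟨h, hh⟩ := ex n g v
  refine ⟨h, hh, ?_⟩
  rintro h' ⟨w', hw'⟩
  obtain ⟨w, hw⟩ := hh
  exact key n w' w h' h (hw'.symm.trans hw)

/-- `(G, B)` is contracting: for some basis there is a finite set `N ⊂ G` such that for every `g`
the sections of `g` in all sufficiently long words belong to `N`. -/
def IsContracting (B : Biset G) : Prop :=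
  ∃ X : Set B, B.IsBasis X ∧ ∃ N : Set G, N.Finite ∧
    ∀ g : G, ∃ n : ℕ, ∀ m : ℕ, n ≤ m → ∀ v : Fin m → X, ∃ h ∈ N, B.IsSection X g v h

/-- The set `X^{-ω} × G` of formal expressions `… x₂ x₁ · g`; the letter `x_{i+1}` of the
left-infinite sequence is its value at `i`. -/
def LimitPre (B : Biset G) (X : Set B) : Type u := (ℕ → X) × G

/-- The direct product topology on `X^{-ω} × G`, where `X` and `G` are discrete. -/
instance (B : Biset G) (X : Set B) : TopologicalSpace (B.LimitPre X) :=
  @instTopologicalSpaceProd (ℕ → X) G (@Pi.topologicalSpace ℕ (fun _ => X) (fun _ => ⊥)) ⊥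

/-- The element `x_n ⊗ ⋯ ⊗ x_1 · g` of `B^{⊗ n}` given by the end of `… x₂ x₁ · g`. -/
def LimitPre.trunc {B : Biset G} {X : Set B} (p : B.LimitPre X) (n : ℕ) : tensorPow B n :=
  op p.2 • B.word n (fun i => (p.1 i : B))

/-- Asymptotic equivalence on `X^{-ω} × G`. -/
def asymptoticSetoid (B : Biset G) (X : Set B) : Setoid (B.LimitPre X) where
  r p q := ∃ A : Set G, A.Finite ∧ ∃ γ : ℕ → G, (∀ n, γ n ∈ A) ∧ ∀ n, γ n • p.trunc n = q.trunc n
  iseqv :=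
    { refl := fun p => ⟨{1}, Set.finite_singleton 1, fun _ => 1, fun _ => rfl, fun _ => one_smul _ _⟩
      symm := by
        rintro p q ⟨A, hA, γ, hγ, h⟩
        refine ⟨(fun g => g⁻¹) '' A, hA.image _, fun n => (γ n)⁻¹,
          fun n => ⟨γ n, hγ n, rfl⟩, fun n => ?_⟩
        rw [← h n, inv_smul_smul]
      trans := by
        rintro p q r ⟨A, hA, γ, hγ, h⟩ ⟨A', hA', γ', hγ', h'⟩
        refine ⟨Set.image2 (fun a b => a * b) A' A, hA'.image2 _ hA, fun n => γ' n * γ n,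
          fun n => ⟨γ' n, hγ' n, γ n, hγ n, rfl⟩, fun n => ?_⟩
        rw [mul_smul, h n, h' n] }

/-- The limit `G`-space: the quotient of `X^{-ω} × G` by the asymptotic equivalence. -/
def LimitGSpace (B : Biset G) (X : Set B) : Type u := Quotient (B.asymptoticSetoid X)

instance (B : Biset G) (X : Set B) : TopologicalSpace (B.LimitGSpace X) :=
  inferInstanceAs (TopologicalSpace (Quotient (B.asymptoticSetoid X)))

/-- The right action of `G` on the limit `G`-space: `(… x₂ x₁ · g) · h = … x₂ x₁ · gh`. -/
instance (B : Biset G) (X : Set B) : MulAction Gᵐᵒᵖ (B.LimitGSpace X) where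
  smul h := Quotient.map (fun p => (p.1, p.2 * h.unop)) (by
    rintro p q ⟨A, hA, γ, hγ, e⟩
    refine ⟨A, hA, γ, hγ, fun n => ?_⟩
    have key : ∀ p : B.LimitPre X,
        LimitPre.trunc (B := B) (X := X) (p.1, p.2 * h.unop) n = h • p.trunc n := by
      intro p
      simp [LimitPre.trunc, mul_smul]
    rw [key, key, smul_comm, e n])
  one_smul := by
    rintro ⟨p⟩
    exact congrArg (Quotient.mk _) (Prod.ext rfl (mul_one p.2))
  mul_smul := by
    rintro g h ⟨p⟩
    exact congrArg (Quotient.mk _) (Prod.ext rfl (mul_assoc p.2 h.unop g.unop).symm)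

/-- The limit space: the space of orbits of the limit `G`-space, with the quotient topology. -/
def LimitSpace (B : Biset G) (X : Set B) : Type u :=
  Quotient (MulAction.orbitRel Gᵐᵒᵖ (B.LimitGSpace X))

instance (B : Biset G) (X : Set B) : TopologicalSpace (B.LimitSpace X) :=
  inferInstanceAs (TopologicalSpace (Quotient (MulAction.orbitRel Gᵐᵒᵖ (B.LimitGSpace X))))

end Biset

/-- The space `Y` has covering dimension `≤ d`: every open cover of `Y` is refined by an open cover
such that every point is contained in at most `d + 1` of its elements. -/
def CoveringDimLE (Y : Type u) [TopologicalSpace Y] (d : ℕ) : Prop :=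
  ∀ U : Set (Set Y), (∀ s ∈ U, IsOpen s) → ⋃₀ U = Set.univ →
    ∃ V : Set (Set Y), (∀ t ∈ V, IsOpen t) ∧ ⋃₀ V = Set.univ ∧ (∀ t ∈ V, ∃ s ∈ U, t ⊆ s) ∧
      ∀ y : Y, {t ∈ V | y ∈ t}.encard ≤ d + 1

open Classical in
/-- The covering dimension: the smallest `d : ℕ` such that `CoveringDimLE Y d`, or `∞` if there is
none; the empty space has dimension `⊥` (usually written `-1`). -/
noncomputable def coveringDim (Y : Type u) [TopologicalSpace Y] : WithBot ℕ∞ :=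
  if IsEmpty Y then ⊥ else ((⨅ (d : ℕ) (_ : CoveringDimLE Y d), (d : ℕ∞) : ℕ∞) : WithBot ℕ∞)

/-! The limit `G`-space is a locally compact Hausdorff space on which `G` acts properly
discontinuously and cocompactly, and for a countable group such an action preserves covering
dimension (`coveringDim_eq_coveringDim_quotient`).

Upstairs ≤ downstairs: on compact sets the orbit map is finite-to-one, so covers of a compact set
can be refined through covers of the quotient (`DimLEOn.of_finite_fibers`); countably many
translates of one compact set form a locally finite closed cover, and the sum theorem applies.

Downstairs ≤ upstairs: finite-to-one maps may raise dimension, so the space is stratified by the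
order of the stabilizer. The strata are closed, and near a point whose stabilizer has order exactly
`k` the orbit map is injective on the `k`-th stratum. Descending induction on `k` glues these local
embeddings (`DimLEOn.of_closed_of_locally`).

The topology comes from contraction, which passes to any basis and lets asymptotic equivalence be
tested with one fixed finite set. The relation is then closed, with uniformly bounded movement in
the `G`-coordinate, so the projection from `X^{-ω} × G` is proper. -/

/-! ### Covering dimension relative to a subset -/

/-- The subset `F` has covering dimension `≤ d`: every family of open sets of the ambient space
covering `F` can be shrunk to one that still covers `F` and has order `≤ d + 1` on `F`. -/
def DimLEOn {Y : Type u} [TopologicalSpace Y] (F : Set Y) (d : ℕ) : Prop :=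
  ∀ (ι : Type u) (U : ι → Set Y), (∀ i, IsOpen (U i)) → F ⊆ ⋃ i, U i →
    ∃ V : ι → Set Y, (∀ i, IsOpen (V i)) ∧ (∀ i, V i ⊆ U i) ∧ F ⊆ ⋃ i, V i ∧
      ∀ y ∈ F, {i | y ∈ V i}.encard ≤ d + 1

/-- Choosing one `U i` around each member of a refinement and uniting the members with the same
choice does not raise the order. -/
theorem coveringDimLE_iff_dimLEOn_univ {Y : Type u} [TopologicalSpace Y] {d : ℕ} :
    CoveringDimLE Y d ↔ DimLEOn (Set.univ : Set Y) d := by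
  constructor
  · intro h ι U hU hcov
    obtain ⟨V, hVo, hVc, hVr, hVd⟩ := h (Set.range U) (by rintro _ ⟨i, rfl⟩; exact hU i)
      (by rw [Set.sUnion_range]; exact Set.univ_subset_iff.1 hcov)
    have hV : ∀ t : V, ∃ i, (t : Set Y) ⊆ U i := by
      rintro ⟨t, ht⟩
      obtain ⟨_, ⟨i, rfl⟩, hi⟩ := hVr t ht
      exact ⟨i, hi⟩
    choose f hf using hV
    refine ⟨fun i => ⋃ t : {t : V // f t = i}, ((t : V) : Set Y), fun i => isOpen_iUnion
      fun t => hVo _ t.1.2, fun i => Set.iUnion_subset ?_, fun y _ => ?_, fun y _ => ?_⟩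
    · rintro ⟨t, rfl⟩
      exact hf t
    · obtain ⟨t, ht, hy⟩ : y ∈ ⋃₀ V := hVc ▸ Set.mem_univ y
      exact Set.mem_iUnion.2 ⟨f ⟨t, ht⟩, Set.mem_iUnion.2 ⟨⟨⟨t, ht⟩, rfl⟩, hy⟩⟩
    · have hsub : {i | y ∈ ⋃ t : {t : V // f t = i}, ((t : V) : Set Y)} ⊆
          f '' {t : V | y ∈ (t : Set Y)} := by
        intro i hi
        obtain ⟨⟨t, ht⟩, hy⟩ := Set.mem_iUnion.1 hi
        exact ⟨t, hy, ht⟩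
      refine (Set.encard_le_encard hsub).trans ((Set.encard_image_le _ _).trans ?_)
      rw [← Subtype.val_injective.encard_image]
      refine (Set.encard_le_encard ?_).trans (hVd y)
      rintro _ ⟨t, ht, rfl⟩
      exact ⟨t.2, ht⟩
  · intro h U hU hcov
    obtain ⟨V, hVo, hVU, hVc, hVd⟩ := h U (fun s => s) (fun s => hU s s.2)
      (by rw [← Set.sUnion_eq_iUnion, hcov])
    refine ⟨Set.range V, by rintro _ ⟨i, rfl⟩; exact hVo i,
      by rw [Set.sUnion_range]; exact Set.univ_subset_iff.1 hVc,
      by rintro _ ⟨i, rfl⟩; exact ⟨i, i.2, hVU i⟩, fun y => ?_⟩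
    refine le_trans (Set.encard_le_encard ?_) ((Set.encard_image_le V _).trans
      (hVd y (Set.mem_univ y)))
    rintro _ ⟨⟨i, rfl⟩, hy⟩
    exact ⟨i, hy, rfl⟩

namespace DimLEOn

section

variable {X Y : Type u} [TopologicalSpace X] [TopologicalSpace Y] {d : ℕ}

theorem empty : DimLEOn (∅ : Set Y) d :=
  fun _ U hU _ => ⟨U, hU, fun _ => subset_rfl, Set.empty_subset _, by simp⟩

theorem mono {F F' : Set Y} (h : DimLEOn F' d) (hF : IsClosed F) (hFF' : F ⊆ F') :
    DimLEOn F d := by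
  intro ι U hU hcov
  rcases isEmpty_or_nonempty ι with hι | ⟨⟨i₀⟩⟩
  · obtain rfl : F = ∅ := by simpa using hcov
    exact empty ι U hU hcov
  -- The complement of `F` is absorbed into every member, so the index type stays the same.
  obtain ⟨V, hVo, hVU, hVc, hVd⟩ := h ι (fun i => U i ∪ Fᶜ)
    (fun i => (hU i).union hF.isOpen_compl) (by
      intro y _
      by_cases hy : y ∈ F
      · obtain ⟨i, hi⟩ := Set.mem_iUnion.1 (hcov hy)
        exact Set.mem_iUnion.2 ⟨i, Or.inl hi⟩
      · exact Set.mem_iUnion.2 ⟨i₀, Or.inr hy⟩)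
  refine ⟨fun i => V i ∩ U i, fun i => (hVo i).inter (hU i), fun i => Set.inter_subset_right,
    fun y hy => ?_, fun y hy => ?_⟩
  · obtain ⟨i, hi⟩ := Set.mem_iUnion.1 (hVc (hFF' hy))
    exact Set.mem_iUnion.2 ⟨i, hi, (hVU i hi).resolve_right (not_not_intro hy)⟩
  · exact (Set.encard_le_encard fun i hi => hi.1).trans (hVd y (hFF' hy))

/-- On a compact set an injective continuous map is an embedding; removing `f '' (F \ V i)` from `U
i` gives an ambient open set with the same trace as `V i`. -/
theorem image [T2Space Y] {f : X → Y} (hf : Continuous f) {F : Set X} (h : DimLEOn F d)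
    (hF : IsCompact F) (hinj : Set.InjOn f F) : DimLEOn (f '' F) d := by
  intro ι U hU hcov
  obtain ⟨V, hVo, hVU, hVc, hVd⟩ := h ι (fun i => f ⁻¹' U i) (fun i => (hU i).preimage hf)
    (by rw [← Set.preimage_iUnion]; exact Set.image_subset_iff.1 hcov)
  refine ⟨fun i => U i \ f '' (F \ V i),
    fun i => (hU i).sdiff ((hF.diff (hVo i)).image hf).isClosed, fun i => Set.sdiff_subset, ?_, ?_⟩
  · rintro _ ⟨x, hx, rfl⟩
    obtain ⟨i, hi⟩ := Set.mem_iUnion.1 (hVc hx)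
    refine Set.mem_iUnion.2 ⟨i, hVU i hi, ?_⟩
    rintro ⟨x', ⟨hx', hx'V⟩, e⟩
    exact hx'V (hinj hx' hx e ▸ hi)
  · rintro _ ⟨x, hx, rfl⟩
    refine (Set.encard_le_encard fun i hi => ?_).trans (hVd x hx)
    by_contra hxV
    exact hi.2 ⟨x, ⟨hx, hxV⟩, rfl⟩

/-- A map that is finite-to-one on a compact set does not lower its dimension. -/
theorem of_finite_fibers [T2Space X] [T2Space Y] {f : X → Y} (hf : Continuous f) {F : Set X}
    (hF : IsCompact F) (hfin : ∀ y, (F ∩ f ⁻¹' {y}).Finite)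
    (h : DimLEOn (Set.univ : Set Y) d) : DimLEOn F d := by
  intro ι U hU hcov
  rcases isEmpty_or_nonempty ι with hι | hι
  · obtain rfl : F = ∅ := by simpa using hcov
    exact empty ι U hU hcov
  have hcover : ∀ x : X, x ∈ F → ∃ i, x ∈ U i := fun x hx => Set.mem_iUnion.1 (hcov hx)
  choose! idx hidx using hcover
  choose O hO hOdisj using fun y => (hfin y).t2_separation
  -- Over a point outside `f '' K y`, every point of `F` lies in one of the disjoint neighbourhoods
  -- of the fibre over `y`.
  let K : Y → Set X := fun y => F \ ⋃ x ∈ F ∩ f ⁻¹' {y}, (O y x ∩ U (idx x))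
  have hK : ∀ y, IsClosed (f '' K y) := fun y =>
    ((hF.diff (isOpen_biUnion fun x _ => (hO y x).2.inter (hU _))).image hf).isClosed
  obtain ⟨W, hWo, hWK, hWc, hWd⟩ := h Y (fun y => (f '' K y)ᶜ) (fun y => (hK y).isOpen_compl)
    (fun y _ => Set.mem_iUnion.2 ⟨y, by
      rintro ⟨x, ⟨hxF, hx⟩, rfl⟩
      exact hx (Set.mem_biUnion (⟨hxF, rfl⟩ : x ∈ F ∩ f ⁻¹' {f x}) ⟨(hO _ x).1, hidx x hxF⟩)⟩)
  refine ⟨fun i => ⋃ y, ⋃ x ∈ {x | x ∈ F ∩ f ⁻¹' {y} ∧ idx x = i},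
      f ⁻¹' W y ∩ (O y x ∩ U (idx x)),
    fun i => isOpen_iUnion fun y => isOpen_biUnion fun x _ =>
      ((hWo y).preimage hf).inter ((hO y x).2.inter (hU _)), ?_, ?_, ?_⟩
  · intro i z hz
    simp only [Set.mem_iUnion] at hz
    obtain ⟨y, x, ⟨-, rfl⟩, -, -, hz⟩ := hz
    exact hz
  · intro z hz
    obtain ⟨y, hy⟩ := Set.mem_iUnion.1 (hWc (Set.mem_univ (f z)))
    have hzK : z ∉ K y := fun hzK => hWK y hy ⟨z, hzK, rfl⟩
    have : z ∈ ⋃ x ∈ F ∩ f ⁻¹' {y}, (O y x ∩ U (idx x)) := by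
      by_contra hcon
      exact hzK ⟨hz, hcon⟩
    simp only [Set.mem_iUnion] at this ⊢
    obtain ⟨x, hx, hzx⟩ := this
    exact ⟨idx x, y, x, ⟨hx, rfl⟩, hy, hzx⟩
  · intro z _
    -- For given `y`, disjointness leaves `z` at most one sheet `O y x`, hence one index; so the
    -- order at `z` is at most that of `W` at `f z`.
    have hsub : ∀ y, ∃ i, ∀ x ∈ F ∩ f ⁻¹' {y}, z ∈ O y x → idx x = i := by
      intro y
      by_cases hex : ∃ x ∈ F ∩ f ⁻¹' {y}, z ∈ O y x
      · obtain ⟨x, hx, hzx⟩ := hex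
        refine ⟨idx x, fun x' hx' hzx' => ?_⟩
        by_contra hne
        exact (hOdisj y hx' hx fun e => hne (e ▸ rfl)).le_bot ⟨hzx', hzx⟩
      · exact ⟨hι.some, fun x hx hzx => absurd ⟨x, hx, hzx⟩ hex⟩
    choose φ hφ using hsub
    refine le_trans (Set.encard_le_encard ?_) ((Set.encard_image_le φ _).trans
      (hWd (f z) (Set.mem_univ _)))
    intro i hi
    simp only [Set.mem_ofPred_eq, Set.mem_iUnion] at hi
    obtain ⟨y, x, ⟨hx, rfl⟩, hzW, hzO, -⟩ := hi
    exact ⟨y, hzW, (hφ y x hx hzO).symm⟩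

/-- An open cover of `C` can be changed along a closed subset `F` so that its order on `F` becomes
at most `d + 1`. -/
theorem exists_shrink {F C : Set Y} (h : DimLEOn F d) (hF : IsClosed F) (hFC : F ⊆ C) {ι : Type u}
    {U : ι → Set Y} (hU : ∀ i, IsOpen (U i)) (hcov : C ⊆ ⋃ i, U i) :
    ∃ V : ι → Set Y, (∀ i, IsOpen (V i)) ∧ (∀ i, V i ⊆ U i) ∧ C ⊆ ⋃ i, V i ∧
      (∀ i, U i \ F ⊆ V i) ∧ ∀ y ∈ F, {i | y ∈ V i}.encard ≤ d + 1 := by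
  obtain ⟨V, hVo, hVU, hVc, hVd⟩ := h ι U hU (hFC.trans hcov)
  refine ⟨fun i => V i ∪ U i \ F, fun i => (hVo i).union ((hU i).sdiff hF),
    fun i => Set.union_subset (hVU i) Set.sdiff_subset, fun y hy => ?_,
    fun i => Set.subset_union_right, fun y hy => ?_⟩
  · by_cases hyF : y ∈ F
    · obtain ⟨i, hi⟩ := Set.mem_iUnion.1 (hVc hyF)
      exact Set.mem_iUnion.2 ⟨i, Or.inl hi⟩
    · obtain ⟨i, hi⟩ := Set.mem_iUnion.1 (hcov hy)
      exact Set.mem_iUnion.2 ⟨i, Or.inr ⟨hi, hyF⟩⟩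
  · refine (Set.encard_le_encard fun i hi => ?_).trans (hVd y hy)
    exact hi.resolve_right fun h => h.2 hy

/-- The sum theorem for countable locally finite closed covers. -/
theorem of_locallyFinite {F : ℕ → Set Y} (hF : ∀ n, IsClosed (F n)) (hlf : LocallyFinite F)
    (hcovF : ⋃ n, F n = Set.univ) (h : ∀ n, DimLEOn (F n) d) :
    DimLEOn (Set.univ : Set Y) d := by
  intro ι U hU hcov
  let S := {V : ι → Set Y // (∀ i, IsOpen (V i)) ∧ Set.univ ⊆ ⋃ i, V i}
  have step : ∀ (n : ℕ) (V : S), ∃ W : S, (∀ i, W.1 i ⊆ V.1 i) ∧ (∀ i, V.1 i \ F n ⊆ W.1 i) ∧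
      ∀ y ∈ F n, {i | y ∈ W.1 i}.encard ≤ d + 1 := by
    rintro n ⟨V, hVo, hVc⟩
    obtain ⟨W, h1, h2, h3, h4, h5⟩ := (h n).exists_shrink (hF n) (Set.subset_univ _) hVo hVc
    exact ⟨⟨W, h1, h3⟩, h2, h4, h5⟩
  choose next hsub hdiff hord using step
  let V : ℕ → S := fun n => Nat.rec ⟨U, hU, hcov⟩ (fun n W => next n W) n
  have hanti : ∀ i, Antitone fun n => (V n).1 i := fun i =>
    antitone_nat_of_succ_le fun n => hsub n (V n) i
  -- Stage `n` changes nothing off `F n`, and a small neighbourhood meets finitely many `F n`; the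
  -- sequence is locally eventually constant, so its intersection is open.
  have hstab : ∀ y, ∃ O, IsOpen O ∧ y ∈ O ∧ ∃ N, ∀ n, N ≤ n → ∀ i, O ∩ (V N).1 i ⊆ (V n).1 i := by
    intro y
    obtain ⟨t, ht, hfin⟩ := hlf y
    obtain ⟨O, hOt, hO, hyO⟩ := mem_nhds_iff.1 ht
    obtain ⟨N, hN⟩ := hfin.bddAbove
    refine ⟨O, hO, hyO, N + 1, fun n hn i => ?_⟩
    induction n, hn using Nat.le_induction with
    | base => exact Set.inter_subset_right
    | succ n hn ih =>
      intro z hz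
      refine hdiff n (V n) i ⟨ih hz, fun hzF => ?_⟩
      have := hN (show n ∈ {n | (F n ∩ t).Nonempty} from ⟨z, hzF, hOt hz.1⟩)
      omega
  refine ⟨fun i => ⋂ n, (V n).1 i, fun i => isOpen_iff_mem_nhds.2 fun y hy => ?_,
    fun i => Set.iInter_subset _ 0, fun y _ => ?_, fun y _ => ?_⟩
  · obtain ⟨O, hO, hyO, N, hN⟩ := hstab y
    refine Filter.mem_of_superset ((hO.inter ((V N).2.1 i)).mem_nhds
      ⟨hyO, Set.mem_iInter.1 hy N⟩) fun z hz => Set.mem_iInter.2 fun n => ?_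
    rcases le_total N n with hn | hn
    · exact hN n hn i hz
    · exact hanti i hn hz.2
  · obtain ⟨O, hO, hyO, N, hN⟩ := hstab y
    obtain ⟨i, hi⟩ := Set.mem_iUnion.1 ((V N).2.2 (Set.mem_univ y))
    refine Set.mem_iUnion.2 ⟨i, Set.mem_iInter.2 fun n => ?_⟩
    rcases le_total N n with hn | hn
    · exact hN n hn i ⟨hyO, hi⟩
    · exact hanti i hn hi
  · obtain ⟨n, hn⟩ := Set.mem_iUnion.1 (hcovF ▸ Set.mem_univ y : y ∈ ⋃ n, F n)
    exact le_trans (Set.encard_le_encard (t := {i | y ∈ (V (n + 1)).1 i})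
      fun i hi => Set.mem_iInter.1 hi (n + 1)) (hord n (V n) y hn)

/-- If a closed subset `A` of a compact set `C` has dimension `≤ d` and so has `C` locally at every
point outside of `A`, then `C` has dimension `≤ d`. -/
theorem of_closed_of_locally [T2Space Y] [NormalSpace Y] {A C : Set Y} (hC : IsCompact C)
    (hA : IsClosed A) (hAC : A ⊆ C) (h : DimLEOn A d)
    (hloc : ∀ y ∈ C \ A, ∃ F O : Set Y, IsClosed F ∧ DimLEOn F d ∧ IsOpen O ∧ y ∈ O ∧
      O ∩ C ⊆ F ∧ F ⊆ C) : DimLEOn C d := by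
  classical
  intro ι U hU hcov
  -- Only finitely many members are kept nonempty: this permits the closed shrinking `W` and makes
  -- the intersection in `hnear` open.
  obtain ⟨s, hs⟩ := hC.elim_finite_subcover U hU hcov
  obtain ⟨V, hVo, hVU, hVc, -, hVd⟩ := h.exists_shrink hA hAC
    (U := fun i => if i ∈ s then U i else ∅)
    (fun i => by split_ifs; exacts [hU i, isOpen_empty]) (by
      intro y hy
      obtain ⟨i, hi, hyi⟩ := Set.mem_iUnion₂.1 (hs hy)
      exact Set.mem_iUnion.2 ⟨i, by rwa [if_pos hi]⟩)
  have hVs : ∀ i ∉ s, V i = ∅ := fun i hi => by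
    have := hVU i
    rw [if_neg hi] at this
    exact Set.subset_empty_iff.1 this
  obtain ⟨W, hWc, hWo, hWV⟩ := exists_subset_iUnion_closure_subset hC.isClosed hVo
    (fun y _ => s.finite_toSet.subset fun i (hi : y ∈ V i) => by
      by_contra his
      rw [hVs i his] at hi
      exact hi) hVc
  have hWs : ∀ i ∉ s, W i = ∅ := fun i hi =>
    Set.subset_empty_iff.1 ((subset_closure.trans (hWV i)).trans (hVs i hi).subset)
  -- Avoiding the finitely many `closure (W i)` with `y ∉ V i` spreads the order bound from `A` to
  -- an open neighbourhood.
  have hnear : ∀ y ∈ A, ∃ O, IsOpen O ∧ y ∈ O ∧ ∀ z ∈ O, {i | z ∈ W i}.encard ≤ d + 1 := by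
    intro y hy
    refine ⟨⋂ i ∈ s.filter fun i => y ∉ V i, (closure (W i))ᶜ,
      isOpen_biInter_finset fun i _ => isClosed_closure.isOpen_compl, ?_, fun z hz => ?_⟩
    · refine Set.mem_iInter₂.2 fun i hi hyi => (Finset.mem_filter.1 hi).2 (hWV i hyi)
    · refine (Set.encard_le_encard fun i hi => ?_).trans (hVd y hy)
      by_contra hyi
      have his : i ∈ s := by
        by_contra his
        rw [Set.mem_ofPred_eq, hWs i his] at hi
        exact hi
      exact Set.mem_iInter₂.1 hz i (Finset.mem_filter.2 ⟨his, hyi⟩) (subset_closure hi)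
  let N : Set Y := ⋃₀ {O | IsOpen O ∧ ∀ z ∈ O, {i | z ∈ W i}.encard ≤ d + 1}
  have hNo : IsOpen N := isOpen_sUnion fun O hO => hO.1
  have hAN : A ⊆ N := fun y hy => by
    obtain ⟨O, hO, hyO, hz⟩ := hnear y hy
    exact ⟨O, ⟨hO, hz⟩, hyO⟩
  have hloc' : ∀ y : Y, ∃ F O : Set Y, y ∈ C \ N → IsClosed F ∧ DimLEOn F d ∧ IsOpen O ∧ y ∈ O ∧
      O ∩ C ⊆ F ∧ F ⊆ C := by
    intro y
    by_cases hy : y ∈ C \ N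
    · obtain ⟨F, O, hFO⟩ := hloc y ⟨hy.1, fun hyA => hy.2 (hAN hyA)⟩
      exact ⟨F, O, fun _ => hFO⟩
    · exact ⟨∅, ∅, fun h => absurd h hy⟩
  choose F O hFO using hloc'
  obtain ⟨t, htC, ht⟩ := (hC.diff hNo).elim_nhds_subcover O
    fun y hy => (hFO y hy).2.2.1.mem_nhds (hFO y hy).2.2.2.1
  -- Further shrinking never raises the order, so the bounds on `N` and on the earlier `F y`
  -- survive.
  have hfinal : ∀ t' : Finset Y, (∀ y ∈ t', y ∈ C \ N) → ∃ V' : ι → Set Y, (∀ i, IsOpen (V' i)) ∧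
      (∀ i, V' i ⊆ W i) ∧ C ⊆ ⋃ i, V' i ∧ ∀ y ∈ t', ∀ z ∈ F y, {i | z ∈ V' i}.encard ≤ d + 1 := by
    intro t'
    induction t' using Finset.induction_on with
    | empty => exact fun _ => ⟨W, hWo, fun _ => subset_rfl, hWc, by simp⟩
    | insert y t' _ ih =>
      intro hy
      obtain ⟨V', h1, h2, h3, h4⟩ := ih fun z hz => hy z (Finset.mem_insert_of_mem hz)
      obtain ⟨f1, f2, -, -, -, f3⟩ := hFO y (hy y (Finset.mem_insert_self y t'))
      obtain ⟨V'', k1, k2, k3, -, k4⟩ := f2.exists_shrink f1 f3 h1 h3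
      refine ⟨V'', k1, fun i => (k2 i).trans (h2 i), k3, fun z hz w hw => ?_⟩
      rcases Finset.mem_insert.1 hz with rfl | hz
      · exact k4 w hw
      · exact (Set.encard_le_encard fun i hi => k2 i hi).trans (h4 z hz w hw)
  obtain ⟨V', h1, h2, h3, h4⟩ := hfinal t htC
  refine ⟨V', h1, fun i y hy => ?_, h3, fun z hz => ?_⟩
  · have := hVU i (hWV i (subset_closure (h2 i hy)))
    split_ifs at this
    exacts [this, absurd this (Set.notMem_empty y)]
  · by_cases hzN : z ∈ N
    · obtain ⟨O', ⟨-, hO'⟩, hzO'⟩ := hzN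
      exact (Set.encard_le_encard fun i hi => h2 i hi).trans (hO' z hzO')
    · obtain ⟨y, hy, hzO⟩ := Set.mem_iUnion₂.1 (ht ⟨hz, hzN⟩)
      exact h4 y hy z ((hFO y (htC y hy)).2.2.2.2.1 ⟨hzO, hz⟩)

end

end DimLEOn

/-! ### Properly discontinuous cocompact actions -/

section ProperAction

open Topology MulAction

variable {Γ : Type*} {X : Type u} [Group Γ] [TopologicalSpace X] [T2Space X]
  [LocallyCompactSpace X] [MulAction Γ X] [ContinuousConstSMul Γ X] [ProperlyDiscontinuousSMul Γ X]

-- Only finitely many elements move a compact neighbourhood to meet itself, and those moving `x` are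
-- excluded by Hausdorff separation. Thus all identifications inside `K` come from the stabilizer of
-- `x`.
variable (Γ) in
theorem exists_isCompact_nhds_smul_notMem (x : X) :
    ∃ K : Set X, IsCompact K ∧ K ∈ 𝓝 x ∧ ∀ g : Γ, ∀ z ∈ K, g • z ∈ K → g • x = x := by
  obtain ⟨K₀, hK₀, hxK₀⟩ := exists_compact_mem_nhds x
  have hE := ProperlyDiscontinuousSMul.finite_disjoint_inter_image (Γ := Γ) hK₀ hK₀
  have hA : ∀ g : Γ, ∃ A ∈ 𝓝 x, g • x ≠ x → ∀ z ∈ A, g • z ∉ A := by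
    intro g
    by_cases hg : g • x = x
    · exact ⟨Set.univ, Filter.univ_mem, fun h => absurd hg h⟩
    · obtain ⟨u, v, hu, hv, huv⟩ := t2_separation_nhds hg
      exact ⟨v ∩ (g • ·) ⁻¹' u, Filter.inter_mem hv
        ((continuous_const_smul g).continuousAt.preimage_mem_nhds hu),
        fun _ z hz hz' => huv.le_bot ⟨hz.2, hz'.1⟩⟩
  choose A hAx hA using hA
  obtain ⟨K, hKx, hKA, hK⟩ := local_compact_nhds
    (Filter.inter_mem hxK₀ ((Filter.biInter_mem hE).2 fun g _ => hAx g))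
  refine ⟨K, hK, hKx, fun g z hz hgz => ?_⟩
  by_contra hg
  have hgE : g ∈ {γ : Γ | ((γ • ·) '' K₀ ∩ K₀).Nonempty} :=
    ⟨g • z, ⟨z, (hKA hz).1, rfl⟩, (hKA hgz).1⟩
  exact hA g hg z (Set.mem_iInter₂.1 (hKA hz).2 g hgE) (Set.mem_iInter₂.1 (hKA hgz).2 g hgE)

/-- The points whose stabilizer has at least `k` elements. -/
def stabilizerStratum (Γ : Type*) (X : Type u) [Group Γ] [MulAction Γ X] (k : ℕ) : Set X :=
  {x | k ≤ Nat.card (stabilizer Γ x)}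

-- Finiteness makes `Nat.card` a true count; it would be `0` on an infinite stabilizer.
omit [T2Space X] [LocallyCompactSpace X] [ContinuousConstSMul Γ X] in
variable (Γ) in
theorem finite_stabilizer_of_properlyDiscontinuous (x : X) : Finite (stabilizer Γ x) :=
  ((ProperlyDiscontinuousSMul.finite_disjoint_inter_image (Γ := Γ) (isCompact_singleton (x := x))
    isCompact_singleton).subset fun _ hg => ⟨x, ⟨x, rfl, hg⟩, rfl⟩).to_subtype

/-- Stabilizers of points near `x` lie in that of `x`, so their order is upper semicontinuous. -/
theorem isClosed_stabilizerStratum (k : ℕ) : IsClosed (stabilizerStratum Γ X k) := by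
  rw [← isOpen_compl_iff, isOpen_iff_mem_nhds]
  intro x hx
  obtain ⟨K, -, hKx, hK⟩ := exists_isCompact_nhds_smul_notMem Γ x
  refine Filter.mem_of_superset hKx fun z hz hzk =>
    hx (le_trans (b := Nat.card (stabilizer Γ z)) hzk ?_)
  have := finite_stabilizer_of_properlyDiscontinuous Γ x
  exact Nat.card_mono (Set.toFinite (stabilizer Γ x : Set Γ)) fun g hg =>
    hK g z hz (by rwa [mem_stabilizer_iff.1 hg])

theorem smul_mem_stabilizerStratum {Γ : Type*} {X : Type u} [Group Γ] [MulAction Γ X] {k : ℕ}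
    {x : X} (g : Γ) (hx : x ∈ stabilizerStratum Γ X k) : g • x ∈ stabilizerStratum Γ X k := by
  rw [stabilizerStratum, Set.mem_ofPred_eq] at hx ⊢
  rwa [Nat.card_congr (stabilizerEquivStabilizer (rfl : g • x = g • x)).toEquiv] at hx

theorem isClosed_image_stabilizerStratum (k : ℕ) : IsClosed
    (Quotient.mk (orbitRel Γ X) '' stabilizerStratum Γ X k) := by
  rw [← (isQuotientMap_quotient_mk' (s := orbitRel Γ X)).isClosed_preimage]
  convert isClosed_stabilizerStratum (Γ := Γ) (X := X) k
  refine Set.Subset.antisymm ?_ (Set.subset_preimage_image _ _)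
  rintro x ⟨z, hz, e⟩
  obtain ⟨g, rfl⟩ := (orbitRel_apply.1 (Quotient.exact e.symm))
  exact smul_mem_stabilizerStratum g hz

variable {d : ℕ} {T : Set X}

theorem DimLEOn.of_orbitRel_quotient [Countable Γ] (hT : IsCompact T)
    (hcov : ∀ x : X, ∃ g : Γ, g • x ∈ T)
    (h : DimLEOn (Set.univ : Set (Quotient (orbitRel Γ X))) d) :
    DimLEOn (Set.univ : Set X) d := by
  have : T2Space (Quotient (orbitRel Γ X)) := t2Space_of_properlyDiscontinuousSMul_of_t2Space
  have hcomp : ∀ K : Set X, IsCompact K → DimLEOn K d := fun K hK =>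
    of_finite_fibers (f := Quotient.mk (orbitRel Γ X)) continuous_quotient_mk' hK (fun y => by
      rcases (K ∩ Quotient.mk (orbitRel Γ X) ⁻¹' {y}).eq_empty_or_nonempty with he | ⟨x, hxK, rfl⟩
      · rw [he]
        exact Set.finite_empty
      · refine ((ProperlyDiscontinuousSMul.finite_disjoint_inter_image (Γ := Γ) hK hK).image
          (· • x)).subset ?_
        rintro z ⟨hzK, hz⟩
        obtain ⟨g, rfl⟩ := (orbitRel_apply.1 (Quotient.exact hz))
        exact ⟨g, ⟨g • x, ⟨x, hxK, rfl⟩, hzK⟩, rfl⟩) h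
  obtain ⟨e, he⟩ := exists_injective_nat Γ
  -- As `e` is injective, each `F n` is a single translate of `T` or empty.
  let F : ℕ → Set X := fun n => ⋃ g ∈ e ⁻¹' {n}, (g • ·) '' T
  have hFc : ∀ n, IsCompact (F n) := fun n =>
    ((Set.finite_singleton n).preimage he.injOn).isCompact_biUnion
      fun g _ => hT.image (continuous_const_smul g)
  refine of_locallyFinite (F := F) (fun n => (hFc n).isClosed) (fun x => ?_) ?_
    fun n => hcomp _ (hFc n)
  · obtain ⟨K, hK, hxK⟩ := exists_compact_mem_nhds x
    refine ⟨K, hxK, ((ProperlyDiscontinuousSMul.finite_disjoint_inter_image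
      (Γ := Γ) hT hK).image e).subset ?_⟩
    rintro n ⟨z, hzF, hzK⟩
    obtain ⟨g, hg, hz⟩ := Set.mem_iUnion₂.1 hzF
    exact ⟨g, ⟨z, hz, hzK⟩, hg⟩
  · refine Set.eq_univ_of_forall fun x => ?_
    obtain ⟨g, hg⟩ := hcov x
    exact Set.mem_iUnion.2 ⟨e g⁻¹, Set.mem_iUnion₂.2 ⟨g⁻¹, rfl, g • x, hg, inv_smul_smul g x⟩⟩

theorem DimLEOn.orbitRel_quotient (hT : IsCompact T) (hcov : ∀ x : X, ∃ g : Γ, g • x ∈ T)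
    (h : DimLEOn (Set.univ : Set X) d) :
    DimLEOn (Set.univ : Set (Quotient (orbitRel Γ X))) d := by
  have : T2Space (Quotient (orbitRel Γ X)) := t2Space_of_properlyDiscontinuousSMul_of_t2Space
  let π := Quotient.mk (orbitRel Γ X)
  have hπ : Continuous π := continuous_quotient_mk'
  have hπo : IsOpenMap π := isOpenMap_quotient_mk'_mul
  have hπT : π '' T = Set.univ := by
    refine Set.eq_univ_of_forall fun y => ?_
    obtain ⟨x, rfl⟩ := Quotient.exists_rep y
    obtain ⟨g, hg⟩ := hcov x
    exact ⟨g • x, hg, Quotient.sound (orbitRel_apply.2 ⟨g, rfl⟩)⟩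
  have : CompactSpace (Quotient (orbitRel Γ X)) := ⟨hπT ▸ hT.image hπ⟩
  have hE := ProperlyDiscontinuousSMul.finite_disjoint_inter_image (Γ := Γ) hT hT
  set E := {γ : Γ | ((γ • ·) '' T ∩ T).Nonempty}
  -- A point of `T` has its stabilizer inside the finite set `E`, and stabilizers along an orbit are
  -- conjugate.
  have hbound : stabilizerStratum Γ X (Nat.card E + 1) = ∅ := by
    refine Set.eq_empty_of_forall_notMem fun x hx => ?_
    obtain ⟨g, hg⟩ := hcov x
    have h1 : Nat.card E + 1 ≤ Nat.card (stabilizer Γ (g • x)) := smul_mem_stabilizerStratum g hx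
    have h2 : Nat.card (stabilizer Γ (g • x)) ≤ Nat.card E :=
      Nat.card_mono hE fun k hk => ⟨g • x, ⟨g • x, hg, hk⟩, hg⟩
    omega
  have hstep : ∀ j k : ℕ, j + k = Nat.card E + 1 → DimLEOn (π '' stabilizerStratum Γ X k) d := by
    intro j
    induction j with
    | zero =>
      rintro k hk
      obtain rfl : k = Nat.card E + 1 := by omega
      rw [hbound, Set.image_empty]
      exact DimLEOn.empty
    | succ j ih =>
      intro k hk
      refine of_closed_of_locally (isClosed_image_stabilizerStratum k).isCompact
        (isClosed_image_stabilizerStratum (k + 1))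
        (Set.image_mono fun x hx => (Nat.le_succ k).trans hx) (ih (k + 1) (by omega)) ?_
      rintro _ ⟨⟨x, hx, rfl⟩, hx'⟩
      have hxk : Nat.card (stabilizer Γ x) ≤ k := by
        by_contra hcon
        exact hx' ⟨x, not_le.1 hcon, rfl⟩
      obtain ⟨K, hK, hxK, hKs⟩ := exists_isCompact_nhds_smul_notMem Γ x
      have hKk : IsCompact (K ∩ stabilizerStratum Γ X k) :=
        hK.inter_right (isClosed_stabilizerStratum k)
      refine ⟨π '' (K ∩ stabilizerStratum Γ X k), π '' interior K,
        (hKk.image hπ).isClosed, (h.mono hKk.isClosed (Set.subset_univ _)).image hπ hKk ?_,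
        hπo _ isOpen_interior, ⟨x, mem_interior_iff_mem_nhds.2 hxK, rfl⟩, ?_,
        Set.image_mono Set.inter_subset_right⟩
      -- The stabilizer of `w` lies in that of `x` and has at least `k` elements, so the two agree;
      -- the `g` carrying `w` to `z` fixes `x`, hence `w`.
      · rintro z ⟨hzK, hz⟩ w ⟨hwK, hw⟩ e
        obtain ⟨g, rfl⟩ := (orbitRel_apply.1 (Quotient.exact e))
        have hfin := finite_stabilizer_of_properlyDiscontinuous Γ x
        have hsub : (stabilizer Γ w : Set Γ) ⊆ stabilizer Γ x := fun g' hg' =>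
          hKs g' w hwK (by rwa [mem_stabilizer_iff.1 hg'])
        have heq : (stabilizer Γ w : Set Γ) = stabilizer Γ x :=
          Set.eq_of_subset_of_ncard_le hsub (hxk.trans hw) (Set.toFinite _)
        have hg : g ∈ (stabilizer Γ x : Set Γ) := hKs g w hwK hzK
        rw [← heq] at hg
        exact hg
      · rintro _ ⟨⟨z, hz, rfl⟩, ⟨w, hw, e⟩⟩
        obtain ⟨g, rfl⟩ := (orbitRel_apply.1 (Quotient.exact e.symm))
        exact ⟨g • w, ⟨interior_subset hz, smul_mem_stabilizerStratum g hw⟩, rfl⟩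
  have h0 := hstep (Nat.card E + 1) 0 rfl
  rwa [show stabilizerStratum Γ X 0 = Set.univ from Set.eq_univ_of_forall fun x => Nat.zero_le _,
    Set.image_univ, Set.range_eq_univ.2 Quotient.mk_surjective] at h0

/-- A cocompact properly discontinuous action of a countable group does not change the covering
dimension. -/
theorem coveringDim_eq_coveringDim_quotient [Countable Γ] (hT : IsCompact T)
    (hcov : ∀ x : X, ∃ g : Γ, g • x ∈ T) :
    coveringDim X = coveringDim (Quotient (orbitRel Γ X)) := by
  have h1 : IsEmpty X ↔ IsEmpty (Quotient (orbitRel Γ X)) :=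
    ⟨fun _ => ⟨fun y => isEmptyElim y.out⟩,
      fun _ => ⟨fun x => isEmptyElim (Quotient.mk (orbitRel Γ X) x)⟩⟩
  have h2 : ∀ d, CoveringDimLE X d ↔ CoveringDimLE (Quotient (orbitRel Γ X)) d := fun d => by
    rw [coveringDimLE_iff_dimLEOn_univ, coveringDimLE_iff_dimLEOn_univ]
    exact ⟨fun h => h.orbitRel_quotient hT hcov, fun h => h.of_orbitRel_quotient hT hcov⟩
  unfold coveringDim
  simp only [h2]
  by_cases he : IsEmpty X
  · rw [if_pos he, if_pos (h1.1 he)]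
  · rw [if_neg he, if_neg (mt h1.2 he)]

end ProperAction

/-! ### Sections of words and independence of contraction from the basis -/

namespace Biset

open scoped Pointwise

variable {G : Type u} [Group G] {B : Biset G} {X Y : Set B}

theorem IsBasis.exists_eq_op_smul (hX : B.IsBasis X) (b : B) :
    ∃ p : B × G, p.1 ∈ X ∧ b = op p.2 • p.1 := by
  obtain ⟨x, ⟨hx, ⟨k, hk⟩⟩, -⟩ := hX b
  exact ⟨(x, k.unop⁻¹), hx, by simp [← hk]⟩

/-- The representative in the basis `X` of the right orbit of `b`. -/
noncomputable def IsBasis.letter (hX : B.IsBasis X) (b : B) : B :=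
  (hX.exists_eq_op_smul b).choose.1

/-- The element `g` such that `b = x · g` for the letter `x` of `b`. -/
noncomputable def IsBasis.coeff (hX : B.IsBasis X) (b : B) : G :=
  (hX.exists_eq_op_smul b).choose.2

/-- The section of `g` in the word `l`, the first element of which is the leftmost letter. The
letters of the word may be any elements of `B`. -/
noncomputable def IsBasis.sec (hX : B.IsBasis X) : G → List B → G
  | g, [] => g
  | g, b :: l => hX.sec (hX.coeff (g • b)) l

/-- The word over `X` obtained by moving `g` in `g · l` to the right. -/
noncomputable def IsBasis.act (hX : B.IsBasis X) : G → List B → List B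
  | _, [] => []
  | g, b :: l => hX.letter (g • b) :: hX.act (hX.coeff (g • b)) l

namespace IsBasis

theorem letter_mem (hX : B.IsBasis X) (b : B) : hX.letter b ∈ X :=
  (hX.exists_eq_op_smul b).choose_spec.1

theorem op_coeff_smul_letter (hX : B.IsBasis X) (b : B) : op (hX.coeff b) • hX.letter b = b :=
  (hX.exists_eq_op_smul b).choose_spec.2.symm

theorem eq_of_op_smul_eq (hB : B.IsSelfSimilar) (hX : B.IsBasis X) {x y : B} (hx : x ∈ X)
    (hy : y ∈ X) {g h : G} (e : op g • x = op h • y) : x = y ∧ g = h := by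
  have hxy : x = y := (hX x).unique ⟨hx, MulAction.mem_orbit_self _⟩
    ⟨hy, op (g * h⁻¹), by simp [mul_smul, e]⟩
  subst hxy
  refine ⟨rfl, ?_⟩
  have h1 : op (g * h⁻¹) • x = x := by simp [mul_smul, e]
  exact mul_inv_eq_one.1 (hB.free x _ h1)

theorem coeff_op_smul (hB : B.IsSelfSimilar) (hX : B.IsBasis X) (g : G) (b : B) :
    hX.coeff (op g • b) = hX.coeff b * g :=
  (eq_of_op_smul_eq hB hX (hX.letter_mem _) (hX.letter_mem b) (by
    rw [op_coeff_smul_letter, op_mul, mul_smul, op_coeff_smul_letter])).2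

theorem coeff_smul (hB : B.IsSelfSimilar) (hX : B.IsBasis X) (hY : B.IsBasis Y) (g : G) (b : B) :
    hY.coeff (g • b) = hY.coeff (g • hX.letter b) * hX.coeff b := by
  rw [← coeff_op_smul hB, ← smul_comm g, op_coeff_smul_letter]

theorem sec_append (hX : B.IsBasis X) (g : G) (l l' : List B) :
    hX.sec g (l ++ l') = hX.sec (hX.sec g l) l' := by
  induction l generalizing g with
  | nil => rfl
  | cons b l ih => exact ih _

theorem act_append (hX : B.IsBasis X) (g : G) (l l' : List B) :
    hX.act g (l ++ l') = hX.act g l ++ hX.act (hX.sec g l) l' := by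
  induction l generalizing g with
  | nil => rfl
  | cons b l ih => exact congrArg _ (ih _)

theorem length_act (hX : B.IsBasis X) (g : G) (l : List B) :
    (hX.act g l).length = l.length := by
  induction l generalizing g with
  | nil => rfl
  | cons b l ih => exact congrArg Nat.succ (ih _)

theorem act_mem (hX : B.IsBasis X) (g : G) (l : List B) : ∀ x ∈ hX.act g l, x ∈ X := by
  induction l generalizing g with
  | nil => simp [act]
  | cons b l ih =>
    intro x hx
    rcases List.mem_cons.1 hx with rfl | hx
    · exact hX.letter_mem _
    · exact ih _ x hx

/-- The cocycle identity, with `g` moved through over `X` and then `k` over `Y`; setting `k` or `g`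
to `1` compares the two bases. -/
theorem sec_mul (hB : B.IsSelfSimilar) (hY : B.IsBasis Y) (hX : B.IsBasis X) (k g : G)
    (l : List B) : hY.sec (k * g) l = hY.sec k (hX.act g l) * hX.sec g l := by
  induction l generalizing k g with
  | nil => rfl
  | cons b l ih =>
    have h : hY.coeff ((k * g) • b) =
        hY.coeff (k • hX.letter (g • b)) * hX.coeff (g • b) := by
      rw [mul_smul, coeff_smul hB hX hY]
    change hY.sec (hY.coeff ((k * g) • b)) l = _
    rw [h, ih]
    rfl

theorem finite (hB : B.IsSelfSimilar) (hX : B.IsBasis X) : X.Finite := by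
  have := hB.finite_orbits
  have hinj : Function.Injective fun x : X =>
      (Quotient.mk _ (x : B) : MulAction.orbitRel.Quotient Gᵐᵒᵖ B) := by
    intro x y e
    exact Subtype.ext ((hX y).unique ⟨x.2, Quotient.exact e⟩ ⟨y.2, MulAction.mem_orbit_self _⟩)
  exact (Finite.of_injective _ hinj : Finite X)

/-- The sections of `g` in all long words over `X` belong to `N`. -/
def ContractsTo (hX : B.IsBasis X) (N : Set G) : Prop :=
  ∀ g : G, ∃ n : ℕ, ∀ l : List B, (∀ x ∈ l, x ∈ X) → n ≤ l.length → hX.sec g l ∈ N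

theorem ContractsTo.uniform {hX : B.IsBasis X} {N : Set G} (h : hX.ContractsTo N) {A : Set G}
    (hA : A.Finite) : ∃ n : ℕ, ∀ g ∈ A, ∀ l : List B, (∀ x ∈ l, x ∈ X) → n ≤ l.length →
      hX.sec g l ∈ N := by
  choose n hn using h
  obtain ⟨m, hm⟩ := (hA.image n).bddAbove
  exact ⟨m, fun g hg l hl hml => hn g l hl ((hm ⟨g, hg, rfl⟩).trans hml)⟩

theorem ContractsTo.finite_sec (hB : B.IsSelfSimilar) {hX : B.IsBasis X} {N : Set G}
    (h : hX.ContractsTo N) (hN : N.Finite) {A : Set G} (hA : A.Finite) :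
    {k | ∃ g ∈ A, ∃ l : List B, (∀ x ∈ l, x ∈ X) ∧ hX.sec g l = k}.Finite := by
  obtain ⟨n, hn⟩ := h.uniform hA
  have hfin : {l : List B | (∀ x ∈ l, x ∈ X) ∧ l.length < n}.Finite := by
    have : Finite X := hX.finite hB
    refine ((List.finite_length_lt X n).image (List.map Subtype.val)).subset ?_
    rintro l ⟨hl, hln⟩
    exact ⟨l.attachWith (· ∈ X) hl, by simpa using hln, List.attachWith_map_subtype_val hl⟩
  refine ((hA.image2 (fun g l => hX.sec g l) hfin).union hN).subset ?_
  rintro _ ⟨g, hg, l, hl, rfl⟩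
  rcases lt_or_ge l.length n with hln | hln
  · exact Or.inl ⟨g, hg, l, ⟨hl, hln⟩, rfl⟩
  · exact Or.inr (hn g hg l hl hln)

/-- By the cocycle identity, the section of a product is a product of sections in words of the same
length. -/
theorem sec_mem_pow (hB : B.IsSelfSimilar) (hX : B.IsBasis X) {A : Set G} {l : List B}
    {A' : Set G} (h : ∀ g ∈ A, ∀ l' : List B, (∀ x ∈ l', x ∈ X) → l'.length = l.length →
      hX.sec g l' ∈ A') {i : ℕ} {g : G} (hg : g ∈ A ^ i)
      (h1 : hX.sec 1 l = 1) : hX.sec g l ∈ A' ^ i := by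
  induction i generalizing g with
  | zero =>
    rw [pow_zero, Set.mem_one] at hg
    rw [hg, h1, pow_zero]
    exact Set.one_mem_one
  | succ i ih =>
    rw [pow_succ'] at hg ⊢
    obtain ⟨a, ha, b, hb, rfl⟩ := hg
    change hX.sec (a * b) l ∈ _
    rw [sec_mul hB hX hX]
    exact Set.mul_mem_mul (h a ha _ (act_mem _ _ _) (length_act _ _ _)) (ih hb)

theorem sec_one (hB : B.IsSelfSimilar) (hX : B.IsBasis X) {l : List B} (hl : ∀ x ∈ l, x ∈ X) :
    hX.sec 1 l = 1 ∧ hX.act 1 l = l := by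
  induction l with
  | nil => exact ⟨rfl, rfl⟩
  | cons b l ih =>
    have hb := eq_of_op_smul_eq hB hX (hX.letter_mem b) (hl b List.mem_cons_self)
      (g := hX.coeff b) (h := 1) (by rw [op_coeff_smul_letter, op_one, one_smul])
    have := ih fun x hx => hl x (List.mem_cons_of_mem b hx)
    constructor
    · rw [sec, one_smul, hb.2, this.1]
    · rw [act, one_smul, hb.1, hb.2, this.2]

theorem _root_.Set.Finite.pow_nat {M : Type*} [Monoid M] {A : Set M} (hA : A.Finite) (n : ℕ) :
    (A ^ n).Finite := by
  induction n with
  | zero => exact pow_zero A ▸ Set.finite_one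
  | succ n ih => exact pow_succ A n ▸ ih.mul hA

/-- Words over a basis `Y` are words over `X` multiplied by elements of a finite set. -/
theorem ContractsTo.exists_finite_sec_one_mem (hB : B.IsSelfSimilar) {hX : B.IsBasis X}
    (hY : B.IsBasis Y) {N : Set G} (h : hX.ContractsTo N) (hN : N.Finite) :
    ∃ M : Set G, M.Finite ∧ ∀ l : List B, (∀ y ∈ l, y ∈ Y) → hX.sec 1 l ∈ M := by
  -- The set `A` is to contain `1`, `N` and the coefficients of `Y`, and to be closed under
  -- sections.
  let A₀ : Set G := insert 1 (N ∪ hX.coeff '' Y)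
  have hA₀ : A₀.Finite := (hN.union ((hY.finite hB).image _)).insert 1
  let A : Set G := {k | ∃ g ∈ A₀, ∃ l : List B, (∀ x ∈ l, x ∈ X) ∧ hX.sec g l = k}
  have hA : A.Finite := h.finite_sec hB hN hA₀
  have hA₀A : A₀ ⊆ A := fun g hg => ⟨g, hg, [], by simp, rfl⟩
  have h1A : (1 : G) ∈ A := hA₀A (Set.mem_insert _ _)
  have hAA : ∀ g ∈ A, ∀ l : List B, (∀ x ∈ l, x ∈ X) → hX.sec g l ∈ A := by
    rintro _ ⟨g, hg, l, hl, rfl⟩ l' hl'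
    refine ⟨g, hg, l ++ l', fun x hx => ?_, sec_append _ _ _ _⟩
    exact (List.mem_append.1 hx).elim (hl x) (hl' x)
  obtain ⟨m, hm⟩ := h.uniform (hA.mul hA)
  -- Length `m + 1` rather than `m`, so that removing a block strictly shortens the word.
  replace hm : ∀ g ∈ A * A, ∀ l : List B, (∀ x ∈ l, x ∈ X) → l.length = m + 1 → hX.sec g l ∈ A :=
    fun g hg l hl hlm => hA₀A (Set.mem_insert_of_mem _ (Or.inl (hm g hg l hl (by omega))))
  -- Each letter of `Y` contributes at most one new factor from `A`.
  have hshort : ∀ (l : List B), (∀ y ∈ l, y ∈ Y) → ∀ (i : ℕ), ∀ g ∈ A ^ i,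
      hX.sec g l ∈ A ^ (i + l.length) := by
    intro l
    induction l with
    | nil => exact fun _ i g hg => hg
    | cons b l ih =>
      intro hl i g hg
      have e : hX.coeff (g • b) = hX.sec g [hX.letter b] * hX.coeff b := 
        coeff_smul hB hX hX g b
      have hb : ∀ x ∈ [hX.letter b], x ∈ X := by
        simpa using hX.letter_mem b
      have hmem : hX.coeff (g • b) ∈ A ^ (i + 1) := by
        rw [e, pow_succ]
        exact Set.mul_mem_mul
          (sec_mem_pow hB hX (fun g hg l' hl' _ => hAA g hg l' hl') hg (sec_one hB hX hb).1)
          (hA₀A (Set.mem_insert_of_mem _ (Or.inr ⟨b, hl b List.mem_cons_self, rfl⟩)))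
      have := ih (fun y hy => hl y (List.mem_cons_of_mem b hy)) (i + 1) _ hmem
      rwa [add_assoc, add_comm 1] at this
  -- The exponent is self-reproducing: a last block of length `m + 1` contracts `(A * A) ^ (m + 1)`
  -- to `A ^ (m + 1)` and contributes another `A ^ (m + 1)` itself.
  refine ⟨A ^ (2 * (m + 1)), hA.pow_nat _, fun l hl => ?_⟩
  induction hn : l.length using Nat.strong_induction_on generalizing l with
  | _ n ih =>
    subst hn
    rcases lt_or_ge l.length (m + 1) with hlm | hlm
    · have h2 := hshort l hl 0 1 (by simp)
      exact Set.pow_subset_pow_right h1A (by omega) h2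
    · have hsplit := List.take_append_drop (l.length - (m + 1)) l
      set l₁ := l.take (l.length - (m + 1))
      set l₂ := l.drop (l.length - (m + 1))
      have hlen : l₂.length = m + 1 := by
        simp only [l₂, List.length_drop]
        omega
      have hl₁ : ∀ y ∈ l₁, y ∈ Y := fun y hy => hl y (List.mem_of_mem_take hy)
      have hl₂ : ∀ y ∈ l₂, y ∈ Y := fun y hy => hl y (List.mem_of_mem_drop hy)
      have hs := ih l₁.length (by simp only [l₁, List.length_take]; omega) l₁ hl₁ rfl
      rw [pow_mul, pow_two] at hs
      have hact := act_mem hX 1 l₂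
      have e : hX.sec 1 l = hX.sec (hX.sec 1 l₁) (hX.act 1 l₂) * hX.sec 1 l₂ := by
        rw [← sec_mul hB, mul_one, ← sec_append, hsplit]
      rw [e, two_mul, pow_add]
      refine Set.mul_mem_mul (sec_mem_pow hB hX (fun g hg l' hl' hl'm => ?_) hs
        (sec_one hB hX hact).1) ?_
      · exact hm g hg l' hl' (by rw [hl'm, length_act, hlen])
      · simpa [hlen] using hshort l₂ hl₂ 0 1 (by simp)

/-- Contraction does not depend on the choice of the basis. -/
theorem ContractsTo.exists_contractsTo (hB : B.IsSelfSimilar) {hX : B.IsBasis X}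
    (hY : B.IsBasis Y) {N : Set G} (h : hX.ContractsTo N) (hN : N.Finite) :
    ∃ N' : Set G, N'.Finite ∧ hY.ContractsTo N' := by
  obtain ⟨M, hM, hMY⟩ := h.exists_finite_sec_one_mem hB hY hN
  refine ⟨M⁻¹ * (N * M), hM.inv.mul (hN.mul hM), fun g => ?_⟩
  obtain ⟨n, hn⟩ := h g
  refine ⟨n, fun l hl hln => ?_⟩
  -- The `X`-section of `g` in a `Y`-word is computed by changing basis after and before the action
  -- of `g`.
  have e1 : hX.sec g l = hX.sec 1 (hY.act g l) * hY.sec g l := by rw [← sec_mul hB, one_mul]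
  have e2 : hX.sec g l = hX.sec g (hX.act 1 l) * hX.sec 1 l := by rw [← sec_mul hB, mul_one]
  rw [eq_inv_mul_of_mul_eq (e1.symm.trans e2)]
  exact Set.mul_mem_mul (Set.inv_mem_inv.2 (hMY _ (act_mem _ _ _)))
    (Set.mul_mem_mul (hn _ (act_mem _ _ _) (by rwa [length_act])) (hMY l hl))

end IsBasis

/-! ### Words in tensor powers and asymptotic equivalence -/

/-- The letters of a word, from left to right. -/
def letters (B : Biset G) : (n : ℕ) → (Fin n → B) → List B
  | 0, _ => []
  | n + 1, v => v (Fin.last n) :: letters B n (fun i => v i.castSucc)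

theorem exists_letters_eq (l : List B) (hl : ∀ x ∈ l, x ∈ X) :
    ∃ v : Fin l.length → X, B.letters l.length (fun i => (v i : B)) = l := by
  induction l with
  | nil => exact ⟨Fin.elim0, rfl⟩
  | cons b l ih =>
    obtain ⟨v, hv⟩ := ih fun x hx => hl x (List.mem_cons_of_mem b hx)
    refine ⟨Fin.snoc (α := fun _ => X) v ⟨b, hl b List.mem_cons_self⟩, ?_⟩
    simp [letters, hv]

theorem letters_injective (n : ℕ) : Function.Injective (B.letters n) := by
  induction n with
  | zero => exact Function.injective_of_subsingleton _
  | succ n ih =>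
    intro v w h
    obtain ⟨h1, h2⟩ := List.cons.inj h
    have h3 := ih h2
    funext i
    induction i using Fin.lastCases with
    | last => exact h1
    | cast i => exact congrFun h3 i

/-- Links the recursive `act` and `sec` on lists to the left action on tensor powers. -/
theorem IsBasis.smul_word (hX : B.IsBasis X) (g : G) {n : ℕ} (v : Fin n → B) :
    ∃ w : Fin n → X, B.letters n (fun i => (w i : B)) = hX.act g (B.letters n v) ∧
      g • B.word n v = op (hX.sec g (B.letters n v)) • B.word n (fun i => (w i : B)) := by
  induction n generalizing g with
  | zero => exact ⟨Fin.elim0, rfl, show g * (1 : G) = 1 * g by simp⟩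
  | succ n ih =>
    obtain ⟨w, hw, hw'⟩ := ih (hX.coeff (g • v (Fin.last n))) fun i => v i.castSucc
    refine ⟨Fin.snoc (α := fun _ => X) w ⟨hX.letter (g • v (Fin.last n)), hX.letter_mem _⟩, ?_, ?_⟩
    · simp [letters, IsBasis.act, hw]
    · refine Quotient.sound ⟨hX.coeff (g • v (Fin.last n)), ?_⟩
      refine Prod.ext ?_ ?_
      · simp only [Fin.snoc_last]
        rw [eq_comm, op_inv, inv_smul_eq_iff]
        exact (hX.op_coeff_smul_letter _).symm
      · simpa [letters, IsBasis.sec] using hw'.symm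

theorem IsBasis.word_inj (hB : B.IsSelfSimilar) (hX : B.IsBasis X) {n : ℕ} {v w : Fin n → X}
    {g h : G} (e : op g • B.word n (fun i => (v i : B)) = op h • B.word n (fun i => (w i : B))) :
    v = w ∧ g = h := by
  induction n with
  | zero =>
    have e' : (1 : G) * g = 1 * h := e
    exact ⟨Subsingleton.elim _ _, by simpa using e'⟩
  | succ n ih =>
    obtain ⟨k, hk⟩ := Quotient.exact e
    have h1 : ((w (Fin.last n) : X) : B) = op k⁻¹ • ((v (Fin.last n) : X) : B) :=
      congrArg Prod.fst hk
    have h2 : op h • B.word n (fun i => (w i.castSucc : B)) =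
        k • op g • B.word n (fun i => (v i.castSucc : B)) := congrArg Prod.snd hk
    obtain ⟨h3, h4⟩ := eq_of_op_smul_eq hB hX (w (Fin.last n)).2 (v (Fin.last n)).2 (g := 1)
      (h := k⁻¹) (by simpa using h1)
    rw [inv_eq_one.mp h4.symm, one_smul] at h2
    obtain ⟨h5, h6⟩ := ih h2.symm
    refine ⟨funext fun i => ?_, h6⟩
    induction i using Fin.lastCases with
    | last => exact Subtype.ext h3.symm
    | cast i => exact congrFun h5 i

theorem IsContracting.exists_contractsTo (hB : B.IsSelfSimilar) (h : B.IsContracting)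
    (hX : B.IsBasis X) : ∃ N : Set G, N.Finite ∧ hX.ContractsTo N := by
  obtain ⟨X₀, hX₀, N, hN, h⟩ := h
  refine IsBasis.ContractsTo.exists_contractsTo hB (hX := hX₀) hX (N := N) (fun g => ?_) hN
  obtain ⟨n, hn⟩ := h g
  refine ⟨n, fun l hl hnl => ?_⟩
  obtain ⟨v, hv⟩ := exists_letters_eq l hl
  obtain ⟨k, hk, hs⟩ := hn l.length hnl v
  obtain ⟨w, -, hw⟩ := hX₀.smul_word g (fun i => (v i : B))
  rw [hv] at hw
  rwa [(hB.existsUnique_section hX₀ g v).unique ⟨w, hw⟩ hs]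

theorem smul_trunc_eq_iff (hB : B.IsSelfSimilar) (hX : B.IsBasis X) {p q : B.LimitPre X} {n : ℕ}
    {g : G} : g • p.trunc n = q.trunc n ↔
      hX.act g (B.letters n fun i => (p.1 i : B)) = B.letters n (fun i => (q.1 i : B)) ∧
        hX.sec g (B.letters n fun i => (p.1 i : B)) * p.2 = q.2 := by
  obtain ⟨w, hw, hw'⟩ := hX.smul_word g (fun i : Fin n => (p.1 i : B))
  have e : g • p.trunc n = op (hX.sec g (B.letters n fun i => (p.1 i : B)) * p.2) •
      B.word n (fun i => (w i : B)) := by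
    rw [LimitPre.trunc, smul_comm, hw', op_mul, mul_smul]
  rw [e, ← hw]
  constructor
  · intro h
    obtain ⟨h1, h2⟩ := IsBasis.word_inj hB hX (v := w) (w := fun i : Fin n => q.1 i) h
    exact ⟨by rw [h1], h2⟩
  · rintro ⟨h1, h2⟩
    rw [h2, letters_injective n h1]
    rfl

theorem exists_letters_append (x : ℕ → X) (n k : ℕ) : ∃ l : List B, l.length = k ∧
    (∀ b ∈ l, b ∈ X) ∧ B.letters (n + k) (fun i => (x i : B)) = l ++ B.letters n (fun i => x i) := by
  induction k with
  | zero => exact ⟨[], rfl, by simp, rfl⟩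
  | succ k ih =>
    obtain ⟨l, hl, hlX, e⟩ := ih
    refine ⟨(x (n + k) : B) :: l, congrArg Nat.succ hl, ?_, ?_⟩
    · intro b hb
      rcases List.mem_cons.1 hb with rfl | hb
      · exact (x _).2
      · exact hlX b hb
    · exact congrArg (List.cons (x (n + k) : B)) e

/-- The asymptotic equivalence can be checked with elements of one fixed finite set. -/
theorem exists_finite_asymptotic_iff (hB : B.IsSelfSimilar) (h : B.IsContracting)
    (hX : B.IsBasis X) : ∃ N : Set G, N.Finite ∧ ∀ p q : B.LimitPre X,
      (B.asymptoticSetoid X).r p q ↔ ∀ n, ∃ g ∈ N, g • p.trunc n = q.trunc n := by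
  obtain ⟨N, hN, hNX⟩ := h.exists_contractsTo hB hX
  refine ⟨N, hN, fun p q => ⟨?_, fun h => ?_⟩⟩
  · rintro ⟨A, hA, γ, hγ, e⟩ n
    -- Level `n` is reached from level `n + k`: the section of `γ (n + k)` in the `k` leftmost
    -- letters lies in `N` and relates the truncations of length `n`.
    obtain ⟨k, hk⟩ := hNX.uniform hA
    obtain ⟨l, hl, hlX, hlp⟩ := exists_letters_append p.1 n k
    obtain ⟨l', hl', -, hlq⟩ := exists_letters_append q.1 n k
    have := (smul_trunc_eq_iff hB hX).1 (e (n + k))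
    rw [hlp, hlq, IsBasis.act_append, IsBasis.sec_append] at this
    refine ⟨_, hk _ (hγ (n + k)) l hlX hl.ge, (smul_trunc_eq_iff hB hX).2 ⟨?_, this.2⟩⟩
    exact (List.append_inj this.1 (by rw [IsBasis.length_act, hl, hl'])).2
  · choose γ hγ e using h
    exact ⟨N, hN, γ, hγ, e⟩

end Biset

/-! ### Proper quotient maps and their targets -/

section ClosedFiniteRelation

open Topology

variable {K G : Type*} [TopologicalSpace K] [CompactSpace K] [T2Space K] [TopologicalSpace G]
  [DiscreteTopology G] [Group G] {s : Setoid (K × G)} {N : Set G}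

/-- Everything equivalent to a point of `K × {h}` lies in the compact set `K × N h`, so saturating a
closed set is, slice by slice, a projection of a compact set. -/
theorem isProperMap_quotient_mk_of_finite (hs : IsClosed {p : (K × G) × (K × G) | s.r p.1 p.2})
    (hN : N.Finite) (hsN : ∀ p q, s.r p q → ∃ g ∈ N, g * p.2 = q.2) :
    IsProperMap (Quotient.mk s) := by
  have hclass : ∀ h : G, IsCompact ((Set.univ : Set K) ×ˢ ((· * h) '' N)) := fun h =>
    isCompact_univ.prod (hN.image _).isCompact
  have hmap : IsClosedMap (Quotient.mk s) := by
    intro C hC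
    rw [← (isQuotientMap_quotient_mk' (s := s)).isClosed_preimage, ← isOpen_compl_iff,
      isOpen_iff_mem_nhds]
    rintro ⟨k, h⟩ hkh
    have hcomp : IsCompact ({p : (K × G) × (K × G) | s.r p.1 p.2} ∩
        (C ∩ Set.univ ×ˢ ((· * h) '' N)) ×ˢ ((Set.univ : Set K) ×ˢ {h})) :=
      (((hclass h).inter_left hC).prod (isCompact_univ.prod isCompact_singleton)).inter_left hs
    have himg := (hcomp.image continuous_snd).isClosed
    refine Filter.mem_of_superset (((isOpen_discrete ({h} : Set G)).preimage
      continuous_snd).inter himg.isOpen_compl |>.mem_nhds ⟨rfl, ?_⟩) ?_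
    · rintro ⟨⟨c, p⟩, ⟨hcp, ⟨hc, -⟩, -⟩, rfl⟩
      exact hkh ⟨c, hc, Quotient.sound hcp⟩
    · rintro ⟨k', h'⟩ ⟨hh, hp⟩ ⟨c, hc, e⟩
      obtain rfl : h' = h := hh
      have hcp : s.r c (k', h') := Quotient.exact e
      obtain ⟨g, hg, hgc⟩ := hsN _ _ (s.symm' hcp)
      exact hp ⟨⟨c, (k', h')⟩, ⟨hcp, ⟨hc, Set.mem_univ _, g, hg, hgc⟩, Set.mem_univ _, rfl⟩, rfl⟩
  refine isProperMap_iff_isClosedMap_and_compact_fibers.2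
    ⟨continuous_quotient_mk', hmap, fun y => ?_⟩
  obtain ⟨⟨k, h⟩, rfl⟩ := Quotient.exists_rep y
  have hclosed : IsClosed (Quotient.mk s ⁻¹' {Quotient.mk s (k, h)}) := by
    rw [← Set.image_singleton]
    exact (hmap _ isClosed_singleton).preimage continuous_quotient_mk'
  refine (hclass h).of_isClosed_subset hclosed fun p hp => ⟨Set.mem_univ _, ?_⟩
  obtain ⟨g, hg, e⟩ := hsN _ _ (Quotient.exact (hp : Quotient.mk s p = _).symm)
  exact ⟨g, hg, e⟩

end ClosedFiniteRelation

section ProperMap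

open Topology

variable {D Q : Type*} [TopologicalSpace D] [TopologicalSpace Q] [T2Space D] {f : D → Q}

theorem IsProperMap.t2Space_of_surjective (hf : IsProperMap f) (hsurj : Function.Surjective f) :
    T2Space Q := by
  refine ⟨fun x y hxy => ?_⟩
  have hfib : ∀ z, IsCompact (f ⁻¹' {z}) :=
    (isProperMap_iff_isClosedMap_and_compact_fibers.1 hf).2.2
  obtain ⟨U, V, hU, hV, hxU, hyV, hUV⟩ := SeparatedNhds.of_isCompact_isCompact (hfib x) (hfib y)
    ((Set.disjoint_singleton.2 hxy).preimage f)
  refine ⟨(f '' Uᶜ)ᶜ, (f '' Vᶜ)ᶜ, (hf.isClosedMap _ hU.isClosed_compl).isOpen_compl,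
    (hf.isClosedMap _ hV.isClosed_compl).isOpen_compl, ?_, ?_, ?_⟩
  · rintro ⟨d, hd, hdx⟩
    exact hd (hxU hdx)
  · rintro ⟨d, hd, hdy⟩
    exact hd (hyV hdy)
  · refine Set.disjoint_left.2 fun z hzU hzV => ?_
    obtain ⟨d, rfl⟩ := hsurj z
    refine hUV.le_bot (⟨?_, ?_⟩ : d ∈ U ∩ V)
    · by_contra hd
      exact hzU ⟨d, hd, rfl⟩
    · by_contra hd
      exact hzV ⟨d, hd, rfl⟩

omit [T2Space D] in
theorem IsProperMap.weaklyLocallyCompactSpace_of_surjective [LocallyCompactSpace D]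
    (hf : IsProperMap f) (hsurj : Function.Surjective f) : WeaklyLocallyCompactSpace Q := by
  refine ⟨fun x => ?_⟩
  obtain ⟨L, hL, hxL⟩ := exists_compact_superset
    ((isProperMap_iff_isClosedMap_and_compact_fibers.1 hf).2.2 x)
  have hopen : IsOpen (f '' (interior L)ᶜ)ᶜ :=
    (hf.isClosedMap _ isOpen_interior.isClosed_compl).isOpen_compl
  refine ⟨f '' L, hL.image hf.continuous,
    Filter.mem_of_superset (hopen.mem_nhds ?_) fun z hz => ?_⟩
  · rintro ⟨d, hd, hdx⟩
    exact hd (hxL hdx)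
  · obtain ⟨d, rfl⟩ := hsurj z
    by_contra hd
    exact hz ⟨d, fun hdL => hd ⟨d, interior_subset hdL, rfl⟩, rfl⟩

end ProperMap

/-! ### Topology of the limit `G`-space and conclusion -/

namespace Biset

open Topology

variable {G : Type u} [Group G] {B : Biset G} {X : Set B}

/-- The projection of `X^{-ω} × G` onto the limit `G`-space. -/
def LimitGSpace.mk (p : B.LimitPre X) : B.LimitGSpace X := Quotient.mk (B.asymptoticSetoid X) p

theorem LimitGSpace.continuous_mk :
    Continuous (LimitGSpace.mk : B.LimitPre X → B.LimitGSpace X) := continuous_quotient_mk'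

theorem LimitPre.isLocallyConstant_trunc (n : ℕ) :
    IsLocallyConstant fun p : B.LimitPre X => p.trunc n := by
  let : TopologicalSpace X := ⊥
  let : TopologicalSpace G := ⊥
  have : DiscreteTopology X := ⟨rfl⟩
  have : DiscreteTopology G := ⟨rfl⟩
  have h : Continuous fun p : (ℕ → X) × G => ((fun i : Fin n => p.1 i, p.2) : (Fin n → X) × G) := by
    fun_prop
  exact (IsLocallyConstant.of_discrete fun q : (Fin n → X) × G =>
    op q.2 • B.word n (fun i => (q.1 i : B))).comp_continuous h

/-- With `N` fixed, equivalence is an intersection over `n` of clopen conditions on truncations. -/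
theorem LimitGSpace.isProperMap_mk (hB : B.IsSelfSimilar) (hcontr : B.IsContracting)
    (hX : B.IsBasis X) : IsProperMap (LimitGSpace.mk : B.LimitPre X → B.LimitGSpace X) := by
  obtain ⟨N, hN, hasymp⟩ := exists_finite_asymptotic_iff hB hcontr hX
  have hclosed : IsClosed {p : B.LimitPre X × B.LimitPre X | (B.asymptoticSetoid X).r p.1 p.2} := by
    simp only [hasymp, Set.ofPred_forall]
    refine isClosed_iInter fun n => ?_
    have hlc : IsLocallyConstant fun p : B.LimitPre X × B.LimitPre X =>
        (p.1.trunc n, p.2.trunc n) :=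
      ((LimitPre.isLocallyConstant_trunc n).comp_continuous continuous_fst).prodMk
        ((LimitPre.isLocallyConstant_trunc n).comp_continuous continuous_snd)
    exact ⟨hlc {q : B.tensorPow n × B.tensorPow n | ∃ g ∈ N, g • q.1 = q.2}ᶜ⟩
  let : TopologicalSpace X := ⊥
  let : TopologicalSpace G := ⊥
  have : DiscreteTopology X := ⟨rfl⟩
  have : DiscreteTopology G := ⟨rfl⟩
  have : Finite X := hX.finite hB
  refine isProperMap_quotient_mk_of_finite (s := B.asymptoticSetoid X) hclosed hN fun p q h => ?_
  obtain ⟨g, hg, e⟩ := (hasymp p q).1 h 0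
  refine ⟨g, hg, ?_⟩
  -- The zeroth tensor power is `G`, so level `0` compares just the group coordinates.
  have e' : g * ((1 : G) * p.2) = 1 * q.2 := e
  simpa using e'

end Biset

theorem mainTheorem7 {G : Type u} [Group G] [Countable G] (B : Biset G)
    (hB : B.IsSelfSimilar) (hcontr : B.IsContracting) (X : Set B) (hX : B.IsBasis X) :
    coveringDim (B.LimitGSpace X) = coveringDim (B.LimitSpace X) := by
  have hproper := Biset.LimitGSpace.isProperMap_mk hB hcontr hX
  have hsurj : Function.Surjective (Biset.LimitGSpace.mk : B.LimitPre X → B.LimitGSpace X) :=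
    Quotient.mk_surjective
  let : TopologicalSpace X := ⊥
  let : TopologicalSpace G := ⊥
  have : DiscreteTopology X := ⟨rfl⟩
  have : DiscreteTopology G := ⟨rfl⟩
  have : Finite X := hX.finite hB
  have : T2Space (B.LimitPre X) := inferInstanceAs (T2Space ((ℕ → X) × G))
  have : LocallyCompactSpace (B.LimitPre X) :=
    inferInstanceAs (LocallyCompactSpace ((ℕ → X) × G))
  have := hproper.t2Space_of_surjective hsurj
  have := hproper.weaklyLocallyCompactSpace_of_surjective hsurj
  have : ContinuousConstSMul Gᵐᵒᵖ (B.LimitGSpace X) := ⟨fun h => by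
    have h1 : Continuous fun p : (ℕ → X) × G => (p.1, p.2 * h.unop) :=
      continuous_fst.prodMk ((continuous_of_discreteTopology (f := (· * h.unop))).comp
        continuous_snd)
    exact continuous_quot_lift _ (Biset.LimitGSpace.continuous_mk.comp h1)⟩
  -- Properness leaves finitely many group coordinates over a compact set, and an element taking
  -- coordinate `a` to `b` is `a⁻¹ * b`.
  have : ProperlyDiscontinuousSMul Gᵐᵒᵖ (B.LimitGSpace X) := ⟨fun {A L} hA hL => by
    have hfin : ∀ A : Set (B.LimitGSpace X), IsCompact A →
        ((Prod.snd : (ℕ → X) × G → G) '' (Biset.LimitGSpace.mk ⁻¹' A)).Finite := fun A hA =>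
      ((hproper.isCompact_preimage hA).image continuous_snd).finite_of_discrete
    refine ((hfin A hA).image2 (fun a b => op (a⁻¹ * b)) (hfin L hL)).subset ?_
    rintro g ⟨_, ⟨x, hxA, rfl⟩, hxL⟩
    obtain ⟨p, rfl⟩ := hsurj x
    refine ⟨p.2, ⟨p, hxA, rfl⟩, p.2 * g.unop, ⟨(p.1, p.2 * g.unop), hxL, rfl⟩, by simp⟩⟩
  have hT : IsCompact (Biset.LimitGSpace.mk '' ((Set.univ : Set (ℕ → X)) ×ˢ ({1} : Set G)) :
      Set (B.LimitGSpace X)) :=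
    IsCompact.image (isCompact_univ.prod isCompact_singleton) Biset.LimitGSpace.continuous_mk
  have : Countable Gᵐᵒᵖ := MulOpposite.unop_injective.countable
  refine coveringDim_eq_coveringDim_quotient (Γ := Gᵐᵒᵖ) hT fun x => ?_
  obtain ⟨p, rfl⟩ := hsurj x
  exact ⟨op p.2⁻¹, (p.1, 1), ⟨Set.mem_univ _, rfl⟩,
    congrArg Biset.LimitGSpace.mk (Prod.ext rfl (mul_inv_cancel p.2).symm)⟩
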